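/- Let $\{X_n, n\ge 1\}$ be a strictly stationary and ergodic sequence of real random variables with common distribution function $F$, and let $F^{-1}(t)=\inf\{x: F(x)\ge t\}$ for $0<t<1$. Let $h:\mathbb R\to\mathbb R$ be a Borel measurable function, let $c_{ni}$ ($n\ge 1$, $1\le i\le n$) be real constants, and put $H(t)=h(F^{-1}(t))$. Let $X_{n:1}\le\dots\le X_{n:n}$ be the order statistics of $X_1,\dots,X_n$ and let $$L_n=\frac1n\sum_{i=1}^n c_{ni}\,h(X_{n:i}).$$ Let $c_n(t)=c_{ni}$ for $t\in((i-1)/n,i/n]$, $i=1,\dots,n$, and $c_n(0)=c_{n1}$, and let $$C_n(q)=\frac1n\sum_{i=1}^n|c_{ni}|^q\ \ (1\le q<\infty),\qquad C_n(\infty)=\max_{1\le i\le n}|c_{ni}|.$$ Assume that at least one of the following two conditions holds: (i) $H$ is continuous on $[0,1]$, in the sense that $H$ on $(0,1)$ extends to a continuous function on $[0,1]$, and $\sup_{n\ge1}C_n(1)<\infty$; (ii) there are $1\le p<\infty$ and $1\le q\le\infty$ with $1/p+1/q=1$ (so $q=\infty$ if $p=1$) such that $\mathbf E|h(X_1)|^p<\infty$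 and $\sup_{n\ge1}C_n(q)<\infty$. Then for every $n\ge 1$ the function $c_nH$ is integrable on $[0,1]$, so that $\mu_n=\int_0^1 c_n(t)H(t)\,dt$ exists, and, as $n\to\infty$, $$L_n-\mu_n\to 0\quad\text{almost surely.}$$ -/

import Mathlib

open MeasureTheory ProbabilityTheory Filter Topology Set
open scoped ENNReal

noncomputable section

namespace LStat

/-- The left shift on real sequences. -/
def shift (x : ℕ → ℝ) : ℕ → ℝ := fun i => x (i + 1)

/-- The law of the whole sequence `X` on the product space `ℕ → ℝ`. -/
def seqLaw {Ω : Type*} [MeasurableSpace Ω] (P : Measure Ω) (X : ℕ → Ω → ℝ) :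
    Measure (ℕ → ℝ) :=
  P.map (fun ω i => X i ω)

/-- Strict stationarity: every time translate of the sequence has the same law
as the sequence itself. -/
def StrictlyStationary {Ω : Type*} [MeasurableSpace Ω] (P : Measure Ω) (X : ℕ → Ω → ℝ) :
    Prop :=
  ∀ k : ℕ, seqLaw P (fun i => X (i + k)) = seqLaw P X

/-- Ergodicity: every shift-invariant measurable set of sequences has law-measure zero
or a law-null complement. -/
def ErgodicSeq {Ω : Type*} [MeasurableSpace Ω] (P : Measure Ω) (X : ℕ → Ω → ℝ) : Prop :=
  ∀ A : Set (ℕ → ℝ), MeasurableSet A → shift ⁻¹' A = A →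
    seqLaw P X A = 0 ∨ seqLaw P X Aᶜ = 0

/-- The order statistics of a finite sample: `orderStat x i` is the `(i+1)`-st smallest
of `x 0, …, x (n - 1)`, counted with multiplicity. -/
def orderStat {n : ℕ} (x : Fin n → ℝ) (i : Fin n) : ℝ := x (Tuple.sort x i)

/-- The quantile function `F⁻¹(t) = inf {x : F x ≥ t}`, where `F` is the distribution function
of `ν`. For `0 < t < 1` the set is nonempty and bounded below, so this is a genuine infimum;
only these `t` matter below. -/
def quantile (ν : Measure ℝ) (t : ℝ) : ℝ := sInf {x : ℝ | t ≤ cdf ν x}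

/-- `H = h ∘ F⁻¹`, where `F` is the distribution function of `ν`. -/
def quantKernel (ν : Measure ℝ) (h : ℝ → ℝ) (t : ℝ) : ℝ := h (quantile ν t)

/-- Continuity on `[0,1]` of a function `H` whose values at the endpoints are understood as limits
(`F⁻¹(0) = -∞` always, and `F⁻¹(1)` may be `+∞`): `H` on `(0,1)` is the restriction of a
function that is continuous on `[0,1]`. -/
def ContinuousOnUnit (H : ℝ → ℝ) : Prop :=
  ∃ g : ℝ → ℝ, ContinuousOn g (Icc 0 1) ∧ EqOn g H (Ioo 0 1)

/-- The `L`-statistic `(1/n) ∑ c_{ni} h(X_{n:i})` of the first `n` variables of the sequence.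
Indices start from zero: `X i`, `c n i` stand for the `(i+1)`-st variable and weight. -/
def lStatistic {Ω : Type*} (c : (n : ℕ) → Fin n → ℝ) (h : ℝ → ℝ) (X : ℕ → Ω → ℝ)
    (n : ℕ) (ω : Ω) : ℝ :=
  (1 / (n : ℝ)) * ∑ i : Fin n, c n i * h (orderStat (fun j : Fin n => X j ω) i)

open Classical in
/-- The step function `c_n` on `[0,1]`: it equals `c n i` on `(i/n, (i+1)/n]` for `0 ≤ i < n`,
and `c n 0` at the point `0`. -/
def weightFun (c : (n : ℕ) → Fin n → ℝ) (n : ℕ) (t : ℝ) : ℝ :=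
  ∑ i : Fin n,
    if ((i : ℝ) / n < t ∧ t ≤ ((i : ℝ) + 1) / n) ∨ (t = 0 ∧ (i : ℕ) = 0) then c n i else 0

/-- `C_n(q)`: the mean of `|c_{ni}|^q` if `q < ∞`, the maximum of `|c_{ni}|` if `q = ∞`. -/
def weightSize (c : (n : ℕ) → Fin n → ℝ) (q : ℝ≥0∞) (n : ℕ) : ℝ :=
  if q = ∞ then ⨆ i : Fin n, |c n i|
  else (1 / (n : ℝ)) * ∑ i : Fin n, |c n i| ^ q.toReal

/-- The centering `μ_n = ∫₀¹ c_n(t) H(t) dt`. -/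
def centering (c : (n : ℕ) → Fin n → ℝ) (H : ℝ → ℝ) (n : ℕ) : ℝ :=
  ∫ t in (0 : ℝ)..1, weightFun c n t * H t

end LStat

end

/-! Let `d_n` be the step function on `(0,1]` whose values are the numbers `h (X_{n:i})`. A product
of two step functions on the same grid is again one, so `L_n - μ_n = ∫ c_n (d_n - H)`, and Hölder's
inequality bounds this by `‖c_n‖_q ‖d_n - H‖_p` (`tendsto_mean_sub_integral`). The first factor is
bounded by assumption; it remains to show that almost surely `d_n → H` in `L^p`, where `p = ∞` in
case (i).

The probabilistic input is Birkhoff's theorem for the shift. It gives the strong law for functions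
of the `X_i`, hence uniform convergence of the empirical distribution functions.

In case (i) this convergence shows that the order statistic used at level `t` equals `F⁻¹(v)` for
some `v` near `t`, uniformly in `t` (`exists_near_quantile_eq`), and `H` is uniformly continuous.

In case (ii), a bounded continuous `b` in place of `h` is handled by dominated convergence, since
order statistics converge at continuity points of `F⁻¹`. A general `h` is approximated by such `b`
in `L^p` of the marginal law. The error on the side of `H` has the same norm, because `F⁻¹` carries
Lebesgue measure to that law; on the side of `d_n` its `p`-th power is the sample mean of `|h -
b|^p`, which ignores the ordering and obeys the strong law (`ae_tendsto_eLpNorm_orderArray`). -/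

/-! ### The pointwise ergodic theorem for ergodic maps -/

section PointwiseErgodic

variable {α : Type*}

/-- The running maximum of `0` and the Birkhoff sums of `f` up to time `n`, in recursive form. -/
def birkhoffMax (T : α → α) (f : α → ℝ) : ℕ → α → ℝ
  | 0, _ => 0
  | n + 1, x => max 0 (f x + birkhoffMax T f n (T x))

theorem birkhoffMax_nonneg (T : α → α) (f : α → ℝ) (n : ℕ) (x : α) :
    0 ≤ birkhoffMax T f n x := by
  cases n with
  | zero => exact le_rfl
  | succ n => exact le_max_left _ _

theorem birkhoffMax_le_succ (T : α → α) (f : α → ℝ) (n : ℕ) :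
    ∀ x, birkhoffMax T f n x ≤ birkhoffMax T f (n + 1) x := by
  induction n with
  | zero => exact fun x => le_max_left _ _
  | succ n ih => exact fun x => max_le_max le_rfl (by gcongr; exact ih (T x))

theorem birkhoffSum_le_birkhoffMax (T : α → α) (f : α → ℝ) (n : ℕ) :
    ∀ x, birkhoffSum T f n x ≤ birkhoffMax T f n x := by
  induction n with
  | zero => exact fun x => by simp [birkhoffMax]
  | succ n ih =>
    intro x
    rw [birkhoffSum_succ']
    exact le_max_of_le_right (by gcongr; exact ih (T x))

/-- The recursion transfers bounds in both directions. Hence the set where the maxima stay bounded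
is strictly `T`-invariant, and ergodicity applies to it. -/
theorem bddAbove_birkhoffMax_comp_iff (T : α → α) (f : α → ℝ) (x : α) :
    BddAbove (range fun n => birkhoffMax T f n (T x)) ↔
      BddAbove (range fun n => birkhoffMax T f n x) := by
  constructor
  · rintro ⟨B, hB⟩
    refine ⟨max 0 (f x + B), ?_⟩
    rintro _ ⟨n, rfl⟩
    refine (birkhoffMax_le_succ T f n x).trans (max_le_max le_rfl ?_)
    gcongr
    exact hB ⟨n, rfl⟩
  · rintro ⟨B, hB⟩
    refine ⟨B - f x, ?_⟩
    rintro _ ⟨n, rfl⟩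
    have h1 : birkhoffMax T f (n + 1) x ≤ B := hB ⟨n + 1, rfl⟩
    have h2 : f x + birkhoffMax T f n (T x) ≤ birkhoffMax T f (n + 1) x := le_max_right _ _
    change birkhoffMax T f n (T x) ≤ B - f x
    linarith

variable [MeasurableSpace α] {μ : Measure α} {T : α → α} {f : α → ℝ}

theorem measurable_birkhoffMax (hT : Measurable T) (hf : Measurable f) (n : ℕ) :
    Measurable (birkhoffMax T f n) := by
  induction n with
  | zero => exact measurable_const
  | succ n ih => exact measurable_const.max (hf.add (ih.comp hT))

theorem integrable_birkhoffMax (hT : MeasurePreserving T μ μ) (hf : Integrable f μ) (n : ℕ) :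
    Integrable (birkhoffMax T f n) μ := by
  induction n with
  | zero => exact integrable_zero _ _ _
  | succ n ih =>
    exact (integrable_zero _ _ _).sup (hf.add (hT.integrable_comp_of_integrable ih))

/-- If `f` has negative mean, then its Birkhoff sums under an ergodic map are almost everywhere
bounded above. -/
theorem Ergodic.ae_bddAbove_birkhoffSum (hT : Ergodic T μ) (hfm : Measurable f)
    (hf : Integrable f μ) (hneg : ∫ x, f x ∂μ < 0) :
    ∀ᵐ x ∂μ, BddAbove (range fun n => birkhoffSum T f n x) := by
  set A : Set α := {x | BddAbove (range fun n => birkhoffMax T f n x)} with hA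
  have hAm : MeasurableSet A :=
    measurableSet_bddAbove_range fun n => measurable_birkhoffMax hT.measurable hfm n
  have hAinv : T ⁻¹' A = A := by
    ext x
    exact bddAbove_birkhoffMax_comp_iff T f x
  rcases hT.toPreErgodic.ae_empty_or_univ hAm hAinv with h0 | h1
  · exfalso
    have hunb : ∀ᵐ x ∂μ, x ∉ A := by
      filter_upwards [h0] with x hx
      have : A x = (∅ : Set α) x := hx
      intro hxA
      exact (this ▸ (show A x from hxA) : (∅ : Set α) x)
    -- The integrand equals `max (f x) (-M_n (T x))` with `M_n ≥ 0`. It is thus dominated by `|f|`,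
    -- and it equals `f x` as soon as `M_n (T x) ≥ -f x`, which happens eventually where the maxima
    -- are unbounded.
    have hlim : Tendsto (fun n => ∫ x, (birkhoffMax T f (n + 1) x - birkhoffMax T f n (T x)) ∂μ)
        atTop (𝓝 (∫ x, f x ∂μ)) := by
      refine tendsto_integral_of_dominated_convergence (fun x => |f x|) (fun n => ?_) hf.abs
        (fun n => ?_) ?_
      · exact ((measurable_birkhoffMax hT.measurable hfm (n + 1)).sub
          ((measurable_birkhoffMax hT.measurable hfm n).comp hT.measurable)).aestronglyMeasurable
      · refine Eventually.of_forall fun x => ?_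
        have h1 := birkhoffMax_nonneg T f n (T x)
        rw [Real.norm_eq_abs]
        simp only [birkhoffMax]
        rcases le_total 0 (f x + birkhoffMax T f n (T x)) with h | h
        · rw [max_eq_right h]; simp
        · rw [max_eq_left h, abs_le]
          have := neg_abs_le (f x)
          have := abs_nonneg (f x)
          constructor <;> linarith
      · filter_upwards [hunb] with x hx
        have hx' : ¬ BddAbove (range fun n => birkhoffMax T f n (T x)) := fun h =>
          hx ((bddAbove_birkhoffMax_comp_iff T f x).1 h)
        have hmono : Monotone fun n => birkhoffMax T f n (T x) :=
          monotone_nat_of_le_succ fun n => birkhoffMax_le_succ T f n (T x)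
        have htop := tendsto_atTop_atTop_of_monotone hmono fun b => by
          by_contra! hb
          exact hx' ⟨b, by rintro _ ⟨n, rfl⟩; exact (hb n).le⟩
        refine tendsto_const_nhds.congr' ?_
        filter_upwards [htop.eventually_ge_atTop (-f x)] with n hn
        have : birkhoffMax T f (n + 1) x = f x + birkhoffMax T f n (T x) :=
          max_eq_right (by linarith)
        rw [this]; ring
    -- By invariance of `μ` each integral equals `∫ M_{n+1} - ∫ M_n ≥ 0`, so the limit `∫ f` could
    -- not be negative.
    refine absurd (ge_of_tendsto' hlim fun n => ?_) (not_le.2 hneg)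
    have hcomp : Integrable (fun x => birkhoffMax T f n (T x)) μ :=
      hT.toMeasurePreserving.integrable_comp_of_integrable
        (integrable_birkhoffMax hT.toMeasurePreserving hf n)
    rw [integral_sub (integrable_birkhoffMax hT.toMeasurePreserving hf _) hcomp, sub_nonneg]
    have hmap : ∫ x, birkhoffMax T f n (T x) ∂μ = ∫ x, birkhoffMax T f n x ∂μ := by
      conv_rhs => rw [← hT.map_eq]
      rw [integral_map hT.measurable.aemeasurable
        (measurable_birkhoffMax hT.measurable hfm n).aestronglyMeasurable]
    rw [hmap]
    exact integral_mono (integrable_birkhoffMax hT.toMeasurePreserving hf _)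
      (integrable_birkhoffMax hT.toMeasurePreserving hf _) (birkhoffMax_le_succ T f n)
  · filter_upwards [h1] with x hx
    have hxA : x ∈ A := by
      have : A x = (univ : Set α) x := hx
      exact (this ▸ trivial : A x)
    obtain ⟨B, hB⟩ := hxA
    refine ⟨B, ?_⟩
    rintro _ ⟨n, rfl⟩
    exact (birkhoffSum_le_birkhoffMax T f n x).trans (hB ⟨n, rfl⟩)

/-- The upper half of the pointwise ergodic theorem. -/
theorem Ergodic.ae_eventually_birkhoffAverage_lt [IsProbabilityMeasure μ] (hT : Ergodic T μ)
    (hfm : Measurable f) (hf : Integrable f μ) {a : ℝ} (ha : ∫ x, f x ∂μ < a) :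
    ∀ᵐ x ∂μ, ∀ᶠ n in atTop, birkhoffAverage ℝ T f n x < a := by
  -- The sums of `f - b` are bounded above by some `B`, so the averages of `f` are at most `b + B /
  -- n`; the gap `a - b` absorbs `B / n`.
  obtain ⟨b, hfb, hba⟩ := exists_between ha
  have hneg : ∫ x, (f x - b) ∂μ < 0 := by
    rw [integral_sub hf (integrable_const b)]
    simpa using hfb
  filter_upwards [hT.ae_bddAbove_birkhoffSum (hfm.sub_const b) (hf.sub (integrable_const b)) hneg]
    with x hx
  obtain ⟨B, hB⟩ := hx
  have hlim : Tendsto (fun n : ℕ => B / n) atTop (𝓝 0) := tendsto_const_div_atTop_nhds_zero_nat B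
  filter_upwards [hlim.eventually_lt_const (sub_pos.2 hba), eventually_gt_atTop 0] with n hn hn0
  have hn0' : (0 : ℝ) < n := Nat.cast_pos.2 hn0
  have hs : birkhoffSum T (fun x => f x - b) n x ≤ B := hB ⟨n, rfl⟩
  have hs' : birkhoffSum T (fun x => f x - b) n x = birkhoffSum T f n x - n * b := by
    simp [birkhoffSum]
  rw [hs'] at hs
  rw [birkhoffAverage, smul_eq_mul, inv_mul_lt_iff₀ hn0']
  rw [div_lt_iff₀ hn0'] at hn
  linarith

/-- The pointwise ergodic theorem for an ergodic map. -/
theorem Ergodic.ae_tendsto_birkhoffAverage [IsProbabilityMeasure μ] (hT : Ergodic T μ)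
    (hfm : Measurable f) (hf : Integrable f μ) :
    ∀ᵐ x ∂μ, Tendsto (fun n => birkhoffAverage ℝ T f n x) atTop (𝓝 (∫ x, f x ∂μ)) := by
  set m := ∫ x, f x ∂μ with hm
  have hup : ∀ᵐ x ∂μ, ∀ k : ℕ, ∀ᶠ n in atTop, birkhoffAverage ℝ T f n x < m + 1 / (k + 1) :=
    ae_all_iff.2 fun k => hT.ae_eventually_birkhoffAverage_lt hfm hf (by
      have : (0 : ℝ) < 1 / (k + 1) := Nat.one_div_pos_of_nat
      linarith)
  have hlo : ∀ᵐ x ∂μ, ∀ k : ℕ, ∀ᶠ n in atTop,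
      birkhoffAverage ℝ T (fun x => -f x) n x < -m + 1 / (k + 1) :=
    ae_all_iff.2 fun k => hT.ae_eventually_birkhoffAverage_lt hfm.neg hf.neg (by
      have : (0 : ℝ) < 1 / (k + 1) := Nat.one_div_pos_of_nat
      rw [integral_neg']
      linarith)
  filter_upwards [hup, hlo] with x hx hx'
  rw [Metric.tendsto_atTop']
  intro ε hε
  obtain ⟨k, hk⟩ := exists_nat_one_div_lt hε
  obtain ⟨N, hN⟩ := eventually_atTop.1 ((hx k).and (hx' k))
  refine ⟨N, fun n hn => ?_⟩
  obtain ⟨h1, h2⟩ := hN n hn.le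
  have h3 : birkhoffAverage ℝ T (fun x => -f x) n x = -birkhoffAverage ℝ T f n x := by
    simp [birkhoffAverage, birkhoffSum]
  rw [h3] at h2
  rw [Real.dist_eq, abs_lt]
  constructor <;> linarith

end PointwiseErgodic

namespace LStat

/-! ### The strong law for stationary ergodic sequences -/

section Sequences

variable {Ω : Type*} [MeasurableSpace Ω] {P : Measure Ω} {X : ℕ → Ω → ℝ}

theorem measurable_shift : Measurable shift :=
  measurable_pi_lambda _ fun i => measurable_pi_apply (i + 1)

theorem iterate_shift_apply (k : ℕ) : ∀ (x : ℕ → ℝ) (i : ℕ), shift^[k] x i = x (i + k) := by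
  induction k with
  | zero => exact fun x i => rfl
  | succ k ih =>
    intro x i
    rw [Function.iterate_succ_apply, ih]
    exact congrArg x (by omega)

theorem ergodic_shift_seqLaw (hX : ∀ i, Measurable (X i)) (hstat : StrictlyStationary P X)
    (herg : ErgodicSeq P X) : Ergodic shift (seqLaw P X) where
  measurable := measurable_shift
  map_eq := by
    conv_rhs => rw [← hstat 1]
    rw [seqLaw, Measure.map_map measurable_shift (measurable_pi_lambda _ hX)]
    rfl
  aeconst_set s hs hinv := by
    rw [eventuallyConst_set']
    rcases herg s hs hinv with h | h
    · exact Or.inl (ae_eq_empty.2 h)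
    · exact Or.inr (ae_eq_univ.2 h)

/-- The strong law of large numbers for a stationary ergodic sequence. -/
theorem ae_tendsto_average [IsProbabilityMeasure P] (hX : ∀ i, Measurable (X i))
    (hstat : StrictlyStationary P X) (herg : ErgodicSeq P X) {φ : ℝ → ℝ} (hφ : Measurable φ)
    (hint : Integrable (fun ω => φ (X 0 ω)) P) :
    ∀ᵐ ω ∂P, Tendsto (fun n : ℕ => (1 / (n : ℝ)) * ∑ i : Fin n, φ (X i ω)) atTop
      (𝓝 (∫ x, φ x ∂(P.map (X 0)))) := by
  have hXm : Measurable fun ω i => X i ω := measurable_pi_lambda _ hX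
  have : IsProbabilityMeasure (seqLaw P X) := Measure.isProbabilityMeasure_map hXm.aemeasurable
  have hm : Measurable fun x : ℕ → ℝ => φ (x 0) := hφ.comp (measurable_pi_apply 0)
  have hi : Integrable (fun x : ℕ → ℝ => φ (x 0)) (seqLaw P X) :=
    (integrable_map_measure hm.aestronglyMeasurable hXm.aemeasurable).2 hint
  have key := ae_of_ae_map hXm.aemeasurable
    ((ergodic_shift_seqLaw hX hstat herg).ae_tendsto_birkhoffAverage hm hi)
  have hmean : ∫ x, φ (x 0) ∂(seqLaw P X) = ∫ x, φ x ∂(P.map (X 0)) := by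
    rw [seqLaw, integral_map hXm.aemeasurable hm.aestronglyMeasurable,
      integral_map (hX 0).aemeasurable hφ.aestronglyMeasurable]
  filter_upwards [key] with ω hω
  rw [hmean] at hω
  refine hω.congr fun n => ?_
  simp only [birkhoffAverage, birkhoffSum, iterate_shift_apply, zero_add, smul_eq_mul, one_div]
  rw [Finset.sum_range fun i => φ (X i ω)]

end Sequences

end LStat

namespace LStat

/-! ### The quantile function -/

section Quantile

variable {ν : Measure ℝ} {s t y : ℝ}

theorem nonempty_le_cdf (ht : t < 1) : {x : ℝ | t ≤ cdf ν x}.Nonempty :=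
  (((tendsto_cdf_atTop ν).eventually_const_lt ht).exists).imp fun _ hx => hx.le

theorem bddBelow_le_cdf (ht : 0 < t) : BddBelow {x : ℝ | t ≤ cdf ν x} := by
  obtain ⟨a, ha⟩ := ((tendsto_cdf_atBot ν).eventually_lt_const ht).exists
  refine ⟨a, fun x hx => ?_⟩
  by_contra! hxa
  exact absurd (le_trans hx (monotone_cdf ν hxa.le)) (not_le.2 ha)

/-- Right continuity of the distribution function makes the infimum attained. This yields the Galois
connection `quantile_le_iff`, from which the later facts about quantiles follow. -/
theorem le_cdf_quantile (ht : t ∈ Ioo (0 : ℝ) 1) : t ≤ cdf ν (quantile ν t) := by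
  have hc : Tendsto (cdf ν) (𝓝[>] quantile ν t) (𝓝 (cdf ν (quantile ν t))) :=
    ((cdf ν).right_continuous _).mono_left (nhdsWithin_mono _ Ioi_subset_Ici_self)
  refine ge_of_tendsto hc ?_
  filter_upwards [self_mem_nhdsWithin] with y hy
  obtain ⟨z, hz, hzy⟩ := exists_lt_of_csInf_lt (nonempty_le_cdf ht.2) hy
  exact le_trans hz (monotone_cdf ν hzy.le)

theorem quantile_le_iff (ht : t ∈ Ioo (0 : ℝ) 1) : quantile ν t ≤ y ↔ t ≤ cdf ν y :=
  ⟨fun h => (le_cdf_quantile ht).trans (monotone_cdf ν h),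
    fun h => csInf_le (bddBelow_le_cdf ht.1) h⟩

theorem lt_quantile_iff (ht : t ∈ Ioo (0 : ℝ) 1) : y < quantile ν t ↔ cdf ν y < t := by
  rw [← not_le, quantile_le_iff ht, not_le]

theorem monotoneOn_quantile : MonotoneOn (quantile ν) (Ioo 0 1) := fun _ hs _ ht hst =>
  (quantile_le_iff hs).2 (hst.trans (le_cdf_quantile ht))

theorem restrict_Ioo_eq_restrict_Ioc :
    (volume : Measure ℝ).restrict (Ioo 0 1) = volume.restrict (Ioc 0 1) :=
  Measure.restrict_congr_set Ioo_ae_eq_Ioc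

theorem ae_mem_Ioo : ∀ᵐ t ∂(volume.restrict (Ioc (0 : ℝ) 1)), t ∈ Ioo (0 : ℝ) 1 := by
  rw [← restrict_Ioo_eq_restrict_Ioc]
  exact ae_restrict_mem measurableSet_Ioo

theorem aemeasurable_quantile : AEMeasurable (quantile ν) (volume.restrict (Ioc 0 1)) := by
  rw [← restrict_Ioo_eq_restrict_Ioc]
  exact aemeasurable_restrict_of_monotoneOn measurableSet_Ioo monotoneOn_quantile

/-- The quantile function carries the uniform distribution to `ν`. -/
theorem map_quantile [IsProbabilityMeasure ν] :
    (volume.restrict (Ioc 0 1)).map (quantile ν) = ν := by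
  have : IsFiniteMeasure ((volume.restrict (Ioc (0 : ℝ) 1)).map (quantile ν)) := inferInstance
  refine Measure.ext_of_Iic _ _ fun y => ?_
  rw [Measure.map_apply_of_aemeasurable aemeasurable_quantile measurableSet_Iic,
    ← ofReal_cdf, ← restrict_Ioo_eq_restrict_Ioc, Measure.restrict_apply' measurableSet_Ioo]
  have h1 : quantile ν ⁻¹' Iic y ∩ Ioo 0 1 = Iic (cdf ν y) ∩ Ioo 0 1 := by
    ext t
    simp only [mem_inter_iff, mem_preimage, mem_Iic]
    exact and_congr_left fun ht => quantile_le_iff ht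
  rw [h1, ← Measure.restrict_apply' measurableSet_Ioo, restrict_Ioo_eq_restrict_Ioc,
    Measure.restrict_apply' measurableSet_Ioc, inter_comm, Ioc_inter_Iic,
    min_eq_right (cdf_le_one ν y), Real.volume_Ioc, sub_zero]

/-- The left-hand side is the left limit of the distribution function at the quantile, and every `y`
below the quantile has `cdf ν y < t`. -/
theorem measureReal_Iio_quantile_le [IsProbabilityMeasure ν] (ht : t ∈ Ioo (0 : ℝ) 1) :
    ν.real (Iio (quantile ν t)) ≤ t := by
  have h1 : ν (Iio (quantile ν t)) =
      ENNReal.ofReal (Function.leftLim (cdf ν) (quantile ν t) - 0) := by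
    rw [← (cdf ν).measure_Iio (tendsto_cdf_atBot ν), measure_cdf]
  have h2 : Function.leftLim (cdf ν) (quantile ν t) ≤ t := by
    refine le_of_tendsto ((monotone_cdf ν).tendsto_leftLim _) ?_
    filter_upwards [self_mem_nhdsWithin] with y hy
    exact ((lt_quantile_iff ht).1 hy).le
  rw [Measure.real, h1, sub_zero]
  exact ENNReal.toReal_le_of_le_ofReal ht.1.le (ENNReal.ofReal_le_ofReal h2)

theorem ae_continuousAt_quantile :
    ∀ᵐ t ∂(volume.restrict (Ioc (0 : ℝ) 1)), ContinuousAt (quantile ν) t := by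
  have hc := (monotoneOn_quantile (ν := ν)).countable_not_continuousWithinAt
  filter_upwards [ae_mem_Ioo, ae_restrict_of_ae (hc.ae_notMem volume)] with t ht hn
  by_contra hcon
  exact hn ⟨ht, fun h => hcon (h.continuousAt (isOpen_Ioo.mem_nhds ht))⟩

end Quantile

/-! ### Empirical distribution functions and order statistics -/

section Empirical

/-- The fraction of the sample points that lie in `s`. -/
noncomputable def empFreq {n : ℕ} (x : Fin n → ℝ) (s : Set ℝ) : ℝ :=
  (1 / (n : ℝ)) * ∑ i, s.indicator 1 (x i)

variable {n : ℕ} {x : Fin n → ℝ} {y : ℝ} {i : Fin n}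

theorem monotone_orderStat (x : Fin n → ℝ) : Monotone (orderStat x) := Tuple.monotone_sort x

theorem sum_orderStat (x : Fin n → ℝ) (φ : ℝ → ℝ) : ∑ i, φ (orderStat x i) = ∑ i, φ (x i) :=
  Equiv.sum_comp (Tuple.sort x) fun i => φ (x i)

theorem empFreq_mono {s t : Set ℝ} (h : s ⊆ t) : empFreq x s ≤ empFreq x t := by
  unfold empFreq
  gcongr with i
  exact zero_le_one

theorem empFreq_nonneg (s : Set ℝ) : 0 ≤ empFreq x s := by
  unfold empFreq
  exact mul_nonneg (by positivity)
    (Finset.sum_nonneg fun i _ => indicator_nonneg (fun _ _ => zero_le_one) _)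

theorem empFreq_le_one (s : Set ℝ) : empFreq x s ≤ 1 := by
  refine (empFreq_mono (subset_univ s)).trans ?_
  rcases Nat.eq_zero_or_pos n with rfl | hn
  · simp [empFreq]
  · simp [empFreq, hn.ne']

theorem le_empFreq_of_orderStat_le (h : orderStat x i ≤ y) :
    ((i : ℝ) + 1) / n ≤ empFreq x (Iic y) := by
  rw [empFreq, ← sum_orderStat x ((Iic y).indicator 1), div_eq_inv_mul, one_div]
  gcongr
  calc (i : ℝ) + 1 = ∑ j ∈ Finset.Iic i, (1 : ℝ) := by simp
    _ = ∑ j ∈ Finset.Iic i, (Iic y).indicator 1 (orderStat x j) := by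
        refine Finset.sum_congr rfl fun j hj => ?_
        rw [indicator_of_mem, Pi.one_apply]
        exact (monotone_orderStat x (Finset.mem_Iic.1 hj)).trans h
    _ ≤ _ := Finset.sum_le_sum_of_subset_of_nonneg (Finset.subset_univ _)
        fun j _ _ => indicator_nonneg (fun _ _ => zero_le_one) _

theorem empFreq_le_of_lt_orderStat (h : y < orderStat x i) :
    empFreq x (Iic y) ≤ (i : ℝ) / n := by
  rw [empFreq, ← sum_orderStat x ((Iic y).indicator 1), one_div, div_eq_inv_mul]
  gcongr
  calc ∑ j, (Iic y).indicator (1 : ℝ → ℝ) (orderStat x j)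
      = ∑ j ∈ Finset.Iio i, (Iic y).indicator 1 (orderStat x j) := by
        refine (Finset.sum_subset (Finset.subset_univ _) fun j _ hj => ?_).symm
        rw [indicator_of_notMem]
        rw [Finset.mem_Iio, not_lt] at hj
        exact not_le.2 (h.trans_le (monotone_orderStat x hj))
    _ ≤ ∑ j ∈ Finset.Iio i, (1 : ℝ) :=
        Finset.sum_le_sum fun j _ => indicator_le_self' (fun _ _ => zero_le_one) _
    _ = (i : ℝ) := by simp

/-- The sequence `u` has the Glivenko–Cantelli property with respect to `ν`: its empirical
distribution functions converge to that of `ν` uniformly. -/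
def GlivenkoCantelli (ν : Measure ℝ) (u : ℕ → ℝ) : Prop :=
  ∀ ε > 0, ∀ᶠ n : ℕ in atTop, ∀ y : ℝ,
    |empFreq (fun j : Fin n => u j) (Iic y) - cdf ν y| ≤ ε

/-- By monotonicity, control at finitely many quantiles suffices. Closed half-lines serve for the
lower bound and open ones for the upper bound, so atoms of `ν` do no harm. -/
theorem GlivenkoCantelli.of_tendsto {ν : Measure ℝ} [IsProbabilityMeasure ν] {u : ℕ → ℝ}
    (hle : ∀ m j : ℕ, Tendsto
      (fun n : ℕ => empFreq (fun k : Fin n => u k) (Iic (quantile ν ((j : ℝ) / m)))) atTop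
      (𝓝 (ν.real (Iic (quantile ν ((j : ℝ) / m))))))
    (hlt : ∀ m j : ℕ, Tendsto
      (fun n : ℕ => empFreq (fun k : Fin n => u k) (Iio (quantile ν ((j : ℝ) / m)))) atTop
      (𝓝 (ν.real (Iio (quantile ν ((j : ℝ) / m)))))) :
    GlivenkoCantelli ν u := by
  intro ε hε
  obtain ⟨k, hk⟩ := exists_nat_one_div_lt (half_pos hε)
  -- Half of `ε` pays for the mesh `1 / m`, the other half for the convergence at the nodes.
  set m : ℕ := k + 1 with hm
  have hm0 : (0 : ℝ) < m := by positivity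
  have hmε : 1 / (m : ℝ) < ε / 2 := by rw [hm]; push_cast; exact hk
  have hgrid : ∀ j : ℕ, 0 < j → j < m → (j : ℝ) / m ∈ Ioo (0 : ℝ) 1 := fun j h0 h1 =>
    ⟨by positivity, (div_lt_one hm0).2 (by exact_mod_cast h1)⟩
  have hev1 : ∀ᶠ n : ℕ in atTop, ∀ j ∈ Finset.range m, ν.real (Iic (quantile ν ((j : ℝ) / m))) -
      ε / 2 < empFreq (fun k : Fin n => u k) (Iic (quantile ν ((j : ℝ) / m))) :=
    (Finset.eventually_all _).2 fun j _ => (hle m j).eventually_const_lt (by linarith)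
  have hev2 : ∀ᶠ n : ℕ in atTop, ∀ j ∈ Finset.range m,
      empFreq (fun k : Fin n => u k) (Iio (quantile ν ((j : ℝ) / m))) <
        ν.real (Iio (quantile ν ((j : ℝ) / m))) + ε / 2 :=
    (Finset.eventually_all _).2 fun j _ => (hlt m j).eventually_lt_const (by linarith)
  filter_upwards [hev1, hev2] with n h1 h2 y
  have hF0 := cdf_nonneg ν y
  have hF1 := cdf_le_one ν y
  rw [abs_le]
  constructor
  -- Lower bound: `j / m` is the last node strictly below `cdf ν y`. If there is none, or if `j =
  -- 0`, then `cdf ν y ≤ 1 / m` and nonnegativity of frequencies is enough.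
  · obtain h0 | h0 := (hF0).eq_or_lt
    · have := empFreq_nonneg (x := fun k : Fin n => u k) (Iic y)
      linarith
    have hpos : 0 < (m : ℝ) * cdf ν y := mul_pos hm0 h0
    have hc0 : 0 < ⌈(m : ℝ) * cdf ν y⌉₊ := Nat.ceil_pos.2 hpos
    obtain ⟨j, hj⟩ : ∃ j, ⌈(m : ℝ) * cdf ν y⌉₊ = j + 1 := ⟨_, (Nat.succ_pred_eq_of_pos hc0).symm⟩
    have hjlt : (j : ℝ) < m * cdf ν y := by
      have := Nat.ceil_lt_add_one hpos.le
      rw [hj] at this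
      push_cast at this
      linarith
    have hjge : m * cdf ν y ≤ (j : ℝ) + 1 := by
      have := Nat.le_ceil ((m : ℝ) * cdf ν y)
      rw [hj] at this
      exact_mod_cast this
    have hjF : (j : ℝ) / m ≤ cdf ν y := by rw [div_le_iff₀ hm0]; linarith
    have hFj : cdf ν y ≤ (j : ℝ) / m + 1 / m := by
      rw [← add_div, le_div_iff₀ hm0]; linarith
    have hjm : j < m := by
      have : (j : ℝ) < m := hjlt.trans_le (mul_le_of_le_one_right hm0.le hF1)
      exact_mod_cast this
    rcases Nat.eq_zero_or_pos j with rfl | hj0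
    · have := empFreq_nonneg (x := fun k : Fin n => u k) (Iic y)
      simp only [Nat.cast_zero, zero_div, zero_add] at hFj
      linarith
    have ht := hgrid j hj0 hjm
    have h3 := h1 j (Finset.mem_range.2 hjm)
    have h4 : (j : ℝ) / m ≤ ν.real (Iic (quantile ν ((j : ℝ) / m))) := by
      rw [← cdf_eq_real]; exact le_cdf_quantile ht
    have h5 : empFreq (fun k : Fin n => u k) (Iic (quantile ν ((j : ℝ) / m))) ≤
        empFreq (fun k : Fin n => u k) (Iic y) :=
      empFreq_mono (Iic_subset_Iic.2 ((quantile_le_iff ht).2 hjF))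
    linarith
  -- Upper bound: `j / m` is the first node strictly above `cdf ν y`. If `j ≥ m`, then `cdf ν y + 1
  -- / m ≥ 1` and the trivial bound on frequencies is enough.
  · set j : ℕ := ⌊(m : ℝ) * cdf ν y⌋₊ + 1 with hj
    have hjlt : m * cdf ν y < j := by
      rw [hj]; push_cast; exact Nat.lt_floor_add_one _
    have hjge : (j : ℝ) ≤ m * cdf ν y + 1 := by
      rw [hj]; push_cast
      have := Nat.floor_le (mul_nonneg hm0.le hF0)
      linarith
    have hFj : cdf ν y < (j : ℝ) / m := by rw [lt_div_iff₀ hm0]; linarith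
    have hjF : (j : ℝ) / m ≤ cdf ν y + 1 / m := by
      rw [div_le_iff₀ hm0, add_mul, one_div_mul_cancel hm0.ne']; linarith
    rcases lt_or_ge j m with hjm | hjm
    · have ht := hgrid j (Nat.succ_pos _) hjm
      have h3 := h2 j (Finset.mem_range.2 hjm)
      have h4 := measureReal_Iio_quantile_le (ν := ν) ht
      have h5 : empFreq (fun k : Fin n => u k) (Iic y) ≤
          empFreq (fun k : Fin n => u k) (Iio (quantile ν ((j : ℝ) / m))) :=
        empFreq_mono (Iic_subset_Iio.2 ((lt_quantile_iff ht).2 hFj))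
      linarith
    · have h3 : 1 ≤ (j : ℝ) / m := by
        rw [le_div_iff₀ hm0, one_mul]; exact_mod_cast hjm
      have := empFreq_le_one (x := fun k : Fin n => u k) (Iic y)
      linarith

/-- The Glivenko–Cantelli theorem for stationary ergodic sequences. -/
theorem ae_glivenkoCantelli {Ω : Type*} [MeasurableSpace Ω] {P : Measure Ω}
    [IsProbabilityMeasure P] {X : ℕ → Ω → ℝ} (hX : ∀ i, Measurable (X i))
    (hstat : StrictlyStationary P X) (herg : ErgodicSeq P X) :
    ∀ᵐ ω ∂P, GlivenkoCantelli (P.map (X 0)) fun i => X i ω := by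
  have : IsProbabilityMeasure (P.map (X 0)) :=
    Measure.isProbabilityMeasure_map (hX 0).aemeasurable
  have key : ∀ s : Set ℝ, MeasurableSet s → ∀ᵐ ω ∂P, Tendsto
      (fun n : ℕ => empFreq (fun k : Fin n => X k ω) s) atTop (𝓝 ((P.map (X 0)).real s)) := by
    intro s hs
    have hm : Measurable (s.indicator (1 : ℝ → ℝ)) := measurable_one.indicator hs
    have hi : Integrable (fun ω => s.indicator (1 : ℝ → ℝ) (X 0 ω)) P :=
      (integrable_map_measure hm.aestronglyMeasurable (hX 0).aemeasurable).1
        ((integrable_const (1 : ℝ)).indicator hs)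
    have := ae_tendsto_average hX hstat herg hm hi
    rwa [integral_indicator_one hs] at this
  have h1 := ae_all_iff.2 fun m : ℕ => ae_all_iff.2 fun j : ℕ =>
    key (Iic (quantile (P.map (X 0)) ((j : ℝ) / m))) measurableSet_Iic
  have h2 := ae_all_iff.2 fun m : ℕ => ae_all_iff.2 fun j : ℕ =>
    key (Iio (quantile (P.map (X 0)) ((j : ℝ) / m))) measurableSet_Iio
  filter_upwards [h1, h2] with ω hω1 hω2
  exact .of_tendsto hω1 hω2

end Empirical

end LStat

namespace LStat

/-! ### Step functions -/

section Step

variable {c d : (n : ℕ) → Fin n → ℝ} {n : ℕ} {t : ℝ}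

theorem weightFun_of_mem {i : Fin n} (h1 : (i : ℝ) / n < t) (h2 : t ≤ ((i : ℝ) + 1) / n) :
    weightFun c n t = c n i := by
  have hn : (0 : ℝ) < n := Nat.cast_pos.2 i.pos
  have ht : 0 < t := lt_of_le_of_lt (by positivity) h1
  rw [weightFun, Finset.sum_eq_single i, if_pos (Or.inl ⟨h1, h2⟩)]
  · intro j _ hji
    refine if_neg ?_
    rintro (⟨h3, h4⟩ | ⟨h3, -⟩)
    · apply hji
      have e1 : (j : ℝ) < i + 1 := by
        have := h3.trans_le h2
        rwa [div_lt_div_iff_of_pos_right hn] at this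
      have e2 : (i : ℝ) < j + 1 := by
        have := h1.trans_le h4
        rwa [div_lt_div_iff_of_pos_right hn] at this
      norm_cast at e1 e2
      exact Fin.ext (by omega)
    · exact ht.ne' h3
  · exact fun h => absurd (Finset.mem_univ i) h

theorem exists_index (hn : 1 ≤ n) (ht : t ∈ Ioc (0 : ℝ) 1) :
    ∃ i : Fin n, (i : ℝ) / n < t ∧ t ≤ ((i : ℝ) + 1) / n := by
  have hn0 : (0 : ℝ) < n := Nat.cast_pos.2 hn
  have hpos : 0 < t * n := mul_pos ht.1 hn0
  obtain ⟨j, hj⟩ : ∃ j, ⌈t * n⌉₊ = j + 1 :=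
    ⟨_, (Nat.succ_pred_eq_of_pos (Nat.ceil_pos.2 hpos)).symm⟩
  have h1 : (j : ℝ) < t * n := by
    have := Nat.ceil_lt_add_one hpos.le
    rw [hj] at this
    push_cast at this
    linarith
  have h2 : t * n ≤ (j : ℝ) + 1 := by
    have := Nat.le_ceil (t * n)
    rw [hj] at this
    exact_mod_cast this
  have h3 : j < n := by
    have : (j : ℝ) < n := h1.trans_le (mul_le_of_le_one_left hn0.le ht.2)
    exact_mod_cast this
  exact ⟨⟨j, h3⟩, (div_lt_iff₀ hn0).2 h1, (le_div_iff₀ hn0).2 h2⟩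

/-- Off the grid the step function is `0`, while `φ 0` need not be; hence the restriction on `t` and
`n`. -/
theorem comp_weightFun (φ : ℝ → ℝ) (hn : 1 ≤ n) (ht : t ∈ Ioc (0 : ℝ) 1) :
    φ (weightFun c n t) = weightFun (fun n i => φ (c n i)) n t := by
  obtain ⟨i, h1, h2⟩ := exists_index hn ht
  rw [weightFun_of_mem h1 h2, weightFun_of_mem h1 h2]

theorem weightFun_mul (hn : 1 ≤ n) (ht : t ∈ Ioc (0 : ℝ) 1) :
    weightFun c n t * weightFun d n t = weightFun (fun n i => c n i * d n i) n t := by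
  obtain ⟨i, h1, h2⟩ := exists_index hn ht
  rw [weightFun_of_mem h1 h2, weightFun_of_mem h1 h2, weightFun_of_mem h1 h2]

theorem measurable_weightFun (c : (n : ℕ) → Fin n → ℝ) (n : ℕ) : Measurable (weightFun c n) := by
  unfold weightFun
  refine Finset.measurable_sum _ fun i _ => Measurable.ite ?_ measurable_const measurable_const
  refine MeasurableSet.union (measurableSet_Ioc (a := (i : ℝ) / n) (b := ((i : ℝ) + 1) / n)) ?_
  exact (measurableSet_singleton (0 : ℝ)).inter (MeasurableSet.const ((i : ℕ) = 0))

theorem abs_weightFun_le (c : (n : ℕ) → Fin n → ℝ) (n : ℕ) (t : ℝ) :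
    |weightFun c n t| ≤ ∑ i, |c n i| := by
  unfold weightFun
  refine (Finset.abs_sum_le_sum_abs _ _).trans (Finset.sum_le_sum fun i _ => ?_)
  split_ifs
  · exact le_rfl
  · simp

theorem memLp_weightFun (c : (n : ℕ) → Fin n → ℝ) (n : ℕ) (q : ℝ≥0∞) :
    MemLp (weightFun c n) q (volume.restrict (Ioc 0 1)) :=
  MemLp.of_bound (measurable_weightFun c n).aestronglyMeasurable (∑ i, |c n i|)
    (Eventually.of_forall (abs_weightFun_le c n))

theorem integral_weightFun (c : (n : ℕ) → Fin n → ℝ) (n : ℕ) :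
    ∫ t in Ioc (0 : ℝ) 1, weightFun c n t = (1 / (n : ℝ)) * ∑ i, c n i := by
  rcases Nat.eq_zero_or_pos n with rfl | hn
  · simp [weightFun]
  have hn0 : (0 : ℝ) < n := Nat.cast_pos.2 hn
  have h1 : ∫ t in Ioc (0 : ℝ) 1, weightFun c n t =
      ∫ t in Ioc (0 : ℝ) 1, ∑ i : Fin n,
        (Ioc ((i : ℝ) / n) (((i : ℝ) + 1) / n)).indicator (fun _ => c n i) t := by
    refine setIntegral_congr_fun measurableSet_Ioc fun t ht => ?_
    refine Finset.sum_congr rfl fun i _ => ?_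
    rw [indicator_apply]
    refine if_congr ?_ rfl rfl
    simp [ht.1.ne']
  rw [h1, integral_finsetSum _ fun i _ => (integrable_const _).indicator measurableSet_Ioc,
    Finset.mul_sum]
  refine Finset.sum_congr rfl fun i _ => ?_
  have hsub : Ioc ((i : ℝ) / n) (((i : ℝ) + 1) / n) ⊆ Ioc 0 1 := by
    refine Ioc_subset_Ioc (by positivity) ((div_le_one hn0).2 ?_)
    exact_mod_cast i.2
  rw [setIntegral_indicator measurableSet_Ioc, inter_eq_right.2 hsub, setIntegral_const,
    Real.volume_real_Ioc_of_le (by gcongr; linarith), smul_eq_mul, ← sub_div, add_sub_cancel_left]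

theorem eLpNorm_weightFun (hn : 1 ≤ n) {q : ℝ≥0∞} (hq0 : q ≠ 0) (hq : q ≠ ∞) :
    eLpNorm (weightFun c n) q (volume.restrict (Ioc 0 1)) =
      ENNReal.ofReal (((1 / (n : ℝ)) * ∑ i, |c n i| ^ q.toReal) ^ q.toReal⁻¹) := by
  rw [(memLp_weightFun c n q).eLpNorm_eq_integral_rpow_norm hq0 hq]
  congr 2
  rw [← integral_weightFun fun n i => |c n i| ^ q.toReal]
  exact setIntegral_congr_fun measurableSet_Ioc fun t ht =>
    comp_weightFun (fun x => |x| ^ q.toReal) hn ht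

theorem eLpNorm_weightFun_le {q : ℝ≥0∞} (hq1 : 1 ≤ q) {K : ℝ} (hn : 1 ≤ n)
    (hK : weightSize c q n ≤ K) :
    eLpNorm (weightFun c n) q (volume.restrict (Ioc 0 1)) ≤
      ENNReal.ofReal (if q = ∞ then K else K ^ q.toReal⁻¹) := by
  by_cases hq : q = ∞
  · subst hq
    simp only [weightSize, if_true] at hK ⊢
    rw [eLpNorm_exponent_top]
    refine eLpNormEssSup_le_of_ae_bound ?_
    filter_upwards [ae_restrict_mem measurableSet_Ioc] with t ht
    obtain ⟨i, h1, h2⟩ := exists_index hn ht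
    rw [weightFun_of_mem h1 h2, Real.norm_eq_abs]
    exact (le_ciSup (f := fun i => |c n i|) (Set.finite_range _).bddAbove i).trans hK
  · rw [eLpNorm_weightFun hn (zero_lt_one.trans_le hq1).ne' hq, if_neg hq]
    rw [weightSize, if_neg hq] at hK
    refine ENNReal.ofReal_le_ofReal (Real.rpow_le_rpow ?_ hK (by positivity))
    positivity

/-- If the step functions `c_n` are bounded in `L^q`, and the step functions with values `d_{ni}`
converge to `G` in `L^p`, then the weighted means of the `d_{ni}` approach `∫ c_n G`. -/
theorem tendsto_mean_sub_integral {p q : ℝ≥0∞} [ENNReal.HolderTriple q p 1] {G : ℝ → ℝ}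
    (hq : 1 ≤ q) (hG : MemLp G p (volume.restrict (Ioc 0 1)))
    {K : ℝ} (hK : ∀ n, 1 ≤ n → weightSize c q n ≤ K)
    (hd : Tendsto (fun n => eLpNorm (weightFun d n - G) p (volume.restrict (Ioc 0 1))) atTop
      (𝓝 0)) :
    Tendsto (fun n : ℕ => (1 / (n : ℝ)) * ∑ i, c n i * d n i -
      ∫ t in Ioc (0 : ℝ) 1, weightFun c n t * G t) atTop (𝓝 0) := by
  rw [tendsto_zero_iff_enorm_tendsto_zero]
  have hlim := ENNReal.Tendsto.const_mul
    (a := ENNReal.ofReal (if q = ∞ then K else K ^ q.toReal⁻¹)) hd (Or.inr ENNReal.ofReal_ne_top)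
  rw [mul_zero] at hlim
  refine tendsto_of_tendsto_of_tendsto_of_le_of_le' tendsto_const_nhds hlim
    (Eventually.of_forall fun _ => zero_le) ?_
  filter_upwards [eventually_ge_atTop 1] with n hn
  have hcd : Integrable (fun t => weightFun c n t * weightFun d n t)
      (volume.restrict (Ioc 0 1)) :=
    memLp_one_iff_integrable.1 ((memLp_weightFun d n p).smul (memLp_weightFun c n q))
  have hcG : Integrable (fun t => weightFun c n t * G t) (volume.restrict (Ioc 0 1)) :=
    memLp_one_iff_integrable.1 (hG.smul (memLp_weightFun c n q))
  -- The weighted mean is exactly an integral, so the difference becomes `∫ c_n (d_n - G)` and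
  -- Hölder's inequality applies.
  have h1 : (1 / (n : ℝ)) * ∑ i, c n i * d n i =
      ∫ t in Ioc (0 : ℝ) 1, weightFun c n t * weightFun d n t := by
    rw [← integral_weightFun fun n i => c n i * d n i]
    exact setIntegral_congr_fun measurableSet_Ioc fun t ht => (weightFun_mul hn ht).symm
  rw [h1, ← integral_sub hcd hcG]
  calc _ ≤ ∫⁻ t in Ioc (0 : ℝ) 1, ‖weightFun c n t * weightFun d n t - weightFun c n t * G t‖ₑ :=
        enorm_integral_le_lintegral_enorm _
    _ = eLpNorm (weightFun c n • (weightFun d n - G)) 1 (volume.restrict (Ioc 0 1)) := by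
        rw [eLpNorm_one_eq_lintegral_enorm]
        simp [mul_sub]
    _ ≤ eLpNorm (weightFun c n) q (volume.restrict (Ioc 0 1)) *
          eLpNorm (weightFun d n - G) p (volume.restrict (Ioc 0 1)) :=
        eLpNorm_smul_le_mul_eLpNorm ((memLp_weightFun d n p).1.sub hG.1)
          (memLp_weightFun c n q).1
    _ ≤ _ := by
        gcongr
        exact eLpNorm_weightFun_le hq hn (hK n hn)

end Step

end LStat

namespace LStat

/-! ### Convergence of empirical quantile functions -/

section EmpiricalQuantile

variable {ν : Measure ℝ} {u : ℕ → ℝ} {t : ℝ}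

/-- The array of the values of `h` at the order statistics of the initial segments of `u`. -/
noncomputable def orderArray (h : ℝ → ℝ) (u : ℕ → ℝ) (n : ℕ) (i : Fin n) : ℝ :=
  h (orderStat (fun j : Fin n => u j) i)

/-- An order statistic on the wrong side of a fixed point would make the empirical distribution
function there miss the true one by a fixed amount. -/
theorem GlivenkoCantelli.tendsto_orderStat (hu : GlivenkoCantelli ν u) (ht : t ∈ Ioo (0 : ℝ) 1)
    (hc : ContinuousAt (quantile ν) t) :
    Tendsto (fun n => weightFun (orderArray id u) n t) atTop (𝓝 (quantile ν t)) := by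
  refine tendsto_order.2 ⟨fun a ha => ?_, fun b hb => ?_⟩
  · have hlt := (lt_quantile_iff ht).1 ha
    filter_upwards [hu ((t - cdf ν a) / 2) (by linarith), eventually_ge_atTop 1] with n hn hn1
    obtain ⟨i, h1, h2⟩ := exists_index hn1 (Ioo_subset_Ioc_self ht)
    rw [weightFun_of_mem h1 h2]
    by_contra! hle
    have h3 := le_empFreq_of_orderStat_le (x := fun j : Fin n => u j) hle
    have h4 := (abs_le.1 (hn a)).2
    linarith
  -- Only the upper bound needs continuity: it supplies a level `s > t` whose quantile is still
  -- below `b`, and `s - t` is the required room.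
  · have hev : ∀ᶠ s in 𝓝[>] t, quantile ν s < b ∧ s ∈ Ioo (0 : ℝ) 1 ∧ t < s :=
      ((hc.eventually_lt_const hb).filter_mono nhdsWithin_le_nhds).and
        ((eventually_nhdsWithin_of_eventually_nhds (isOpen_Ioo.eventually_mem ht)).and
          self_mem_nhdsWithin)
    obtain ⟨s, hsb, hs, hts⟩ := hev.exists
    filter_upwards [hu ((s - t) / 2) (by linarith), eventually_ge_atTop 1] with n hn hn1
    obtain ⟨i, h1, h2⟩ := exists_index hn1 (Ioo_subset_Ioc_self ht)
    rw [weightFun_of_mem h1 h2]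
    by_contra! hle
    have h3 := empFreq_le_of_lt_orderStat (x := fun j : Fin n => u j) (hsb.trans_le hle)
    have h4 := (abs_le.1 (hn (quantile ν s))).1
    have h5 := le_cdf_quantile (ν := ν) hs
    linarith

/-- Continuity of `h ∘ F⁻¹` controls `h` only on the range of `F⁻¹`, so the sample has to lie there.
-/
theorem ae_mem_image_quantile [IsProbabilityMeasure ν] :
    ∀ᵐ x ∂ν, x ∈ quantile ν '' Ioo 0 1 := by
  have hm : MeasurableSet (quantile ν '' Ioo 0 1) :=
    measurableSet_Ioo.image_of_monotoneOn monotoneOn_quantile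
  have h : ∀ᵐ x ∂((volume.restrict (Ioc 0 1)).map (quantile ν)), x ∈ quantile ν '' Ioo 0 1 := by
    refine (ae_map_iff aemeasurable_quantile hm).2 ?_
    filter_upwards [ae_mem_Ioo] with t ht
    exact mem_image_of_mem _ ht
  rwa [map_quantile] at h

theorem exists_near_quantile_eq {x ε : ℝ} (hx : x ∈ quantile ν '' Ioo 0 1)
    (ht : t ∈ Ioo (0 : ℝ) 1) (hε : 0 < ε) (hle : t ≤ cdf ν x + ε)
    (hge : ∀ y < x, cdf ν y ≤ t + ε) :
    ∃ v ∈ Ioo (0 : ℝ) 1, |v - t| ≤ 2 * ε ∧ quantile ν v = x := by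
  obtain ⟨w, hw, rfl⟩ := hx
  -- The levels with quantile `x` include all `v ≤ cdf ν x` lying strictly above every `cdf ν y`
  -- with `y < x`. The term `t + 2 * ε`, rather than `t + ε`, makes this strict; in `max w t`, `w`
  -- keeps `v` above those values and `t` keeps it near `t`, while both keep it below `1`.
  set v := min (cdf ν (quantile ν w)) (min (t + 2 * ε) (max w t)) with hv
  have hwF := le_cdf_quantile (ν := ν) hw
  have hv0 : 0 < v :=
    lt_min (hw.1.trans_le hwF) (lt_min (by linarith [ht.1]) (lt_max_of_lt_left hw.1))
  have hv1 : v < 1 := (min_le_right _ _).trans_lt ((min_le_right _ _).trans_lt (max_lt hw.2 ht.2))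
  have hvt : v ≤ t + 2 * ε := (min_le_right _ _).trans (min_le_left _ _)
  have htv : t - ε ≤ v :=
    le_min (by linarith) (le_min (by linarith) (le_max_of_le_right (by linarith)))
  refine ⟨v, ⟨hv0, hv1⟩, abs_le.2 ⟨by linarith, by linarith⟩, le_antisymm ?_ ?_⟩
  · exact (quantile_le_iff ⟨hv0, hv1⟩).2 (min_le_left _ _)
  · refine le_of_forall_lt fun y hy => (lt_quantile_iff ⟨hv0, hv1⟩).2 ?_
    have hyw := (lt_quantile_iff hw).1 hy
    have hyt := hge y hy
    exact lt_min (hyw.trans_le hwF) (lt_min (by linarith) (lt_max_of_lt_left hyw))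

theorem memLp_top_of_continuousOnUnit {H : ℝ → ℝ} (hH : ContinuousOnUnit H) :
    MemLp H ∞ (volume.restrict (Ioc 0 1)) := by
  obtain ⟨g, hg, hgH⟩ := hH
  obtain ⟨C, hC⟩ := isCompact_Icc.exists_bound_of_continuousOn hg
  have hgm : MemLp g ∞ (volume.restrict (Ioc 0 1)) := by
    refine MemLp.of_bound
      ((hg.mono Ioc_subset_Icc_self).aestronglyMeasurable measurableSet_Ioc) C ?_
    filter_upwards [ae_restrict_mem measurableSet_Ioc] with t ht
    exact hC t (Ioc_subset_Icc_self ht)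
  refine hgm.ae_eq ?_
  filter_upwards [ae_mem_Ioo] with t ht
  exact hgH ht

/-- If `h ∘ F⁻¹` is continuous, then the step functions of the values of `h` at the order
statistics converge to it uniformly. -/
theorem GlivenkoCantelli.tendsto_eLpNorm_top {h : ℝ → ℝ} (hu : GlivenkoCantelli ν u)
    (hmem : ∀ i, u i ∈ quantile ν '' Ioo 0 1) (hH : ContinuousOnUnit (quantKernel ν h)) :
    Tendsto (fun n => eLpNorm (weightFun (orderArray h u) n - quantKernel ν h) ∞
      (volume.restrict (Ioc 0 1))) atTop (𝓝 0) := by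
  obtain ⟨g, hg, hgH⟩ := hH
  have huc := isCompact_Icc.uniformContinuousOn_of_continuous hg
  rw [ENNReal.tendsto_nhds_zero]
  intro η hη
  obtain ⟨δ, hδ0, hδη⟩ : ∃ δ : ℝ, 0 < δ ∧ ENNReal.ofReal δ ≤ η := by
    obtain ⟨δ, hδ0, hδ⟩ := ENNReal.lt_iff_exists_nnreal_btwn.1 hη
    exact ⟨δ, by exact_mod_cast hδ0, by simpa using hδ.le⟩
  obtain ⟨ε, hε, hgε⟩ := Metric.uniformContinuousOn_iff.1 huc δ hδ0
  -- The level `v` found below is within `2 * (ε / 3) < ε` of `t`.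
  filter_upwards [hu (ε / 3) (by linarith), eventually_ge_atTop 1] with n hn hn1
  rw [eLpNorm_exponent_top]
  refine le_trans (eLpNormEssSup_le_of_ae_bound (C := δ) ?_) hδη
  filter_upwards [ae_mem_Ioo] with t ht
  obtain ⟨i, h1, h2⟩ := exists_index hn1 (Ioo_subset_Ioc_self ht)
  rw [Pi.sub_apply, weightFun_of_mem h1 h2, orderArray]
  set x := orderStat (fun j : Fin n => u j) i with hx
  obtain ⟨v, hv, hvt, hvx⟩ := exists_near_quantile_eq (ν := ν) (x := x) (hmem _) ht
    (show 0 < ε / 3 by linarith)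
    (by
      have h3 := le_empFreq_of_orderStat_le hx.ge
      have h4 := (abs_le.1 (hn x)).2
      linarith)
    (fun y hy => by
      have h3 := empFreq_le_of_lt_orderStat hy
      have h4 := (abs_le.1 (hn y)).1
      linarith)
  have h5 : h x = g v := by rw [hgH hv, quantKernel, hvx]
  rw [h5, ← hgH ht]
  refine (hgε v (Ioo_subset_Icc_self hv) t (Ioo_subset_Icc_self ht) ?_).le
  rw [Real.dist_eq]
  linarith

/-- For bounded continuous `b`, the step functions of the values of `b` at the order statistics
converge to `b ∘ F⁻¹` in `L^p`. -/
theorem GlivenkoCantelli.tendsto_eLpNorm_boundedContinuous (hu : GlivenkoCantelli ν u)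
    (b : BoundedContinuousFunction ℝ ℝ) {p : ℝ≥0∞} (hp0 : p ≠ 0) (hp : p ≠ ∞) :
    Tendsto (fun n => eLpNorm (weightFun (orderArray b u) n - quantKernel ν b) p
      (volume.restrict (Ioc 0 1))) atTop (𝓝 0) := by
  have hpos : 0 < p.toReal := ENNReal.toReal_pos hp0 hp
  simp_rw [eLpNorm_eq_lintegral_rpow_enorm_toReal hp0 hp]
  have hmeas : AEMeasurable (quantKernel ν b) (volume.restrict (Ioc 0 1)) :=
    b.continuous.measurable.comp_aemeasurable aemeasurable_quantile
  have hbound : ∀ s, ‖b s‖ ≤ ‖b‖ := b.norm_coe_le_norm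
  have hlim : Tendsto (fun n => ∫⁻ t in Ioc (0 : ℝ) 1,
      ‖(weightFun (orderArray b u) n - quantKernel ν b) t‖ₑ ^ p.toReal) atTop
      (𝓝 (∫⁻ _ in Ioc (0 : ℝ) 1, 0)) := by
    refine tendsto_lintegral_of_dominated_convergence'
      (fun _ => ENNReal.ofReal (2 * ‖b‖) ^ p.toReal) (fun n => ?_) (fun n => ?_) ?_ ?_
    · exact (((measurable_weightFun _ n).aemeasurable.sub hmeas).enorm).pow_const _
    · filter_upwards [ae_restrict_mem measurableSet_Ioc] with t ht
      gcongr
      rw [Pi.sub_apply, ← ofReal_norm, two_mul]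
      refine ENNReal.ofReal_le_ofReal ((norm_sub_le _ _).trans (add_le_add ?_ (hbound _)))
      rcases Nat.eq_zero_or_pos n with rfl | hn
      · simp [weightFun]
      · obtain ⟨i, h1, h2⟩ := exists_index hn ht
        rw [weightFun_of_mem h1 h2]
        exact hbound _
    · rw [lintegral_const]
      simp [ENNReal.mul_eq_top]
    · filter_upwards [ae_mem_Ioo, ae_continuousAt_quantile (ν := ν)] with t ht hc
      have h1 := (b.continuous.tendsto _).comp (hu.tendsto_orderStat ht hc)
      have h2 : Tendsto (fun n => (weightFun (orderArray b u) n - quantKernel ν b) t) atTop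
          (𝓝 0) := by
        rw [← sub_self (b (quantile ν t))]
        refine (h1.sub_const _).congr' ?_
        filter_upwards [eventually_ge_atTop 1] with n hn
        rw [Function.comp_apply, comp_weightFun b hn (Ioo_subset_Ioc_self ht)]
        rfl
      have h3 := (ENNReal.continuous_rpow_const (y := p.toReal)).tendsto 0 |>.comp
        (tendsto_zero_iff_enorm_tendsto_zero.1 h2)
      rwa [ENNReal.zero_rpow_of_pos hpos] at h3
  rw [lintegral_zero] at hlim
  have h4 := (ENNReal.continuous_rpow_const (y := 1 / p.toReal)).tendsto 0 |>.comp hlim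
  rwa [ENNReal.zero_rpow_of_pos (by positivity)] at h4

end EmpiricalQuantile

/-! ### Almost sure `L^p` convergence of the empirical quantile functions -/

section Stationary

variable {Ω : Type*} [MeasurableSpace Ω] {P : Measure Ω} {X : ℕ → Ω → ℝ}

theorem StrictlyStationary.map_eq (hstat : StrictlyStationary P X) (hX : ∀ i, Measurable (X i))
    (i : ℕ) : P.map (X i) = P.map (X 0) := by
  have h := congrArg (Measure.map fun x : ℕ → ℝ => x 0) (hstat i)
  rw [seqLaw, seqLaw,
    Measure.map_map (measurable_pi_apply 0) (measurable_pi_lambda _ fun j => hX (j + i)),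
    Measure.map_map (measurable_pi_apply 0) (measurable_pi_lambda _ hX)] at h
  simpa [Function.comp_def] using h

theorem ae_forall_mem_image_quantile [IsProbabilityMeasure P] (hX : ∀ i, Measurable (X i))
    (hstat : StrictlyStationary P X) :
    ∀ᵐ ω ∂P, ∀ i, X i ω ∈ quantile (P.map (X 0)) '' Ioo 0 1 := by
  have : IsProbabilityMeasure (P.map (X 0)) :=
    Measure.isProbabilityMeasure_map (hX 0).aemeasurable
  refine ae_all_iff.2 fun i => ae_of_ae_map (hX i).aemeasurable ?_
  rw [hstat.map_eq hX i]
  exact ae_mem_image_quantile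

theorem memLp_quantKernel {ν : Measure ℝ} [IsProbabilityMeasure ν] {h : ℝ → ℝ} {p : ℝ≥0∞}
    (hh : MemLp h p ν) : MemLp (quantKernel ν h) p (volume.restrict (Ioc 0 1)) := by
  rw [← map_quantile (ν := ν)] at hh
  exact hh.comp_of_map aemeasurable_quantile

theorem eLpNorm_quantKernel {ν : Measure ℝ} [IsProbabilityMeasure ν] {h : ℝ → ℝ}
    (hh : Measurable h) (p : ℝ≥0∞) :
    eLpNorm (quantKernel ν h) p (volume.restrict (Ioc 0 1)) = eLpNorm h p ν := by
  have h1 := eLpNorm_map_measure (p := p) (f := quantile ν) (μ := volume.restrict (Ioc 0 1))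
    hh.aestronglyMeasurable aemeasurable_quantile
  rw [map_quantile] at h1
  exact h1.symm

/-- The `L^p` norm of the step function of the values of `h` at the order statistics converges
to the `L^p` norm of `h` under the marginal law. -/
theorem ae_tendsto_eLpNorm_orderArray [IsProbabilityMeasure P] (hX : ∀ i, Measurable (X i))
    (hstat : StrictlyStationary P X) (herg : ErgodicSeq P X) {h : ℝ → ℝ} (hh : Measurable h)
    {p : ℝ≥0∞} (hp0 : p ≠ 0) (hp : p ≠ ∞) (hmem : MemLp h p (P.map (X 0))) :
    ∀ᵐ ω ∂P, Tendsto (fun n => eLpNorm (weightFun (orderArray h fun i => X i ω) n) p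
      (volume.restrict (Ioc 0 1))) atTop (𝓝 (eLpNorm h p (P.map (X 0)))) := by
  have hm : Measurable fun x => |h x| ^ p.toReal :=
    (measurable_abs.comp hh).pow_const _
  have hint : Integrable (fun ω => |h (X 0 ω)| ^ p.toReal) P :=
    (integrable_map_measure hm.aestronglyMeasurable (hX 0).aemeasurable).1
      (hmem.integrable_norm_rpow hp0 hp)
  filter_upwards [ae_tendsto_average hX hstat herg hm hint] with ω hω
  rw [hmem.eLpNorm_eq_integral_rpow_norm hp0 hp]
  have h1 : Tendsto (fun n : ℕ => ENNReal.ofReal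
      (((1 / (n : ℝ)) * ∑ i : Fin n, |h (X i ω)| ^ p.toReal) ^ p.toReal⁻¹)) atTop
      (𝓝 (ENNReal.ofReal ((∫ x, ‖h x‖ ^ p.toReal ∂(P.map (X 0))) ^ p.toReal⁻¹))) :=
    ENNReal.tendsto_ofReal (hω.rpow_const (Or.inr (by positivity)))
  refine h1.congr' ?_
  filter_upwards [eventually_ge_atTop 1] with n hn
  rw [eLpNorm_weightFun hn hp0 hp]
  simp only [orderArray]
  rw [sum_orderStat (fun j : Fin n => X j ω) fun x => |h x| ^ p.toReal]

/-- If `h` is in `L^p` of the marginal law, then the step functions of the values of `h` at the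
order statistics converge to `h ∘ F⁻¹` in `L^p`, almost surely. -/
theorem ae_tendsto_eLpNorm_sub_quantKernel [IsProbabilityMeasure P] (hX : ∀ i, Measurable (X i))
    (hstat : StrictlyStationary P X) (herg : ErgodicSeq P X) {h : ℝ → ℝ} (hh : Measurable h)
    {p : ℝ≥0∞} (hp1 : 1 ≤ p) (hp : p ≠ ∞) (hmem : MemLp h p (P.map (X 0))) :
    ∀ᵐ ω ∂P, Tendsto (fun n => eLpNorm (weightFun (orderArray h fun i => X i ω) n -
      quantKernel (P.map (X 0)) h) p (volume.restrict (Ioc 0 1))) atTop (𝓝 0) := by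
  set ν := P.map (X 0) with hν
  have : IsProbabilityMeasure ν := Measure.isProbabilityMeasure_map (hX 0).aemeasurable
  have hp0 : p ≠ 0 := (zero_lt_one.trans_le hp1).ne'
  -- Bounded continuous functions are dense in `L^p(ν)` for `p < ∞`. A countable family of
  -- approximants keeps the exceptional null sets countable in number; for `k = 0` the tolerance is
  -- `∞`.
  choose b hb hbmem using fun k : ℕ => hmem.exists_boundedContinuous_eLpNorm_sub_le hp
    (ε := (k : ℝ≥0∞)⁻¹) (ENNReal.inv_ne_zero.2 (ENNReal.natCast_ne_top k))
  have hr : ∀ k, Measurable (h - ⇑(b k)) := fun k => hh.sub (b k).continuous.measurable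
  have hres := ae_all_iff.2 fun k => ae_tendsto_eLpNorm_orderArray hX hstat herg (hr k) hp0 hp
    (hmem.sub (hbmem k))
  filter_upwards [hres, ae_glivenkoCantelli hX hstat herg] with ω hω hgc
  rw [ENNReal.tendsto_nhds_zero]
  intro ε hε
  have hε3 : 0 < ε / 3 := ENNReal.div_pos hε.ne' (by norm_num)
  obtain ⟨k, hk⟩ := ENNReal.exists_inv_nat_lt hε3.ne'
  have hkε := (hb k).trans_lt hk
  filter_upwards [(hω k).eventually_lt_const hkε, ENNReal.tendsto_nhds_zero.1
    (hgc.tendsto_eLpNorm_boundedContinuous (b k) hp0 hp) _ hε3, eventually_ge_atTop 1]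
    with n hn1 hn2 hn
  set w := fun f : ℝ → ℝ => weightFun (orderArray f fun i => X i ω) n with hw
  -- Three errors of at most `ε / 3`: the residual `h - b k` on the sample (strong law), `b k`
  -- itself (dominated convergence), and the residual along the quantile function (equal norms).
  have hdecomp : w h - quantKernel ν h =ᵐ[volume.restrict (Ioc 0 1)]
      w (h - ⇑(b k)) + (w (b k) - quantKernel ν (b k)) - quantKernel ν (h - ⇑(b k)) := by
    filter_upwards [ae_restrict_mem measurableSet_Ioc] with t ht
    obtain ⟨i, h1, h2⟩ := exists_index hn ht
    simp only [hw, Pi.sub_apply, Pi.add_apply, weightFun_of_mem h1 h2, orderArray, quantKernel]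
    ring
  have hmw : ∀ f, AEStronglyMeasurable (w f) (volume.restrict (Ioc 0 1)) := fun f =>
    (measurable_weightFun _ n).aestronglyMeasurable
  have hmq : ∀ f, Measurable f →
      AEStronglyMeasurable (quantKernel ν f) (volume.restrict (Ioc 0 1)) := fun f hf =>
    (hf.comp_aemeasurable aemeasurable_quantile).aestronglyMeasurable
  have hbm := hmq _ (b k).continuous.measurable
  rw [eLpNorm_congr_ae hdecomp, ← ENNReal.add_thirds ε]
  refine (eLpNorm_sub_le ((hmw _).add ((hmw _).sub hbm)) (hmq _ (hr k)) hp1).trans ?_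
  refine add_le_add ((eLpNorm_add_le (hmw _) ((hmw _).sub hbm) hp1).trans
    (add_le_add hn1.le hn2)) ?_
  rw [eLpNorm_quantKernel (hr k)]
  exact hkε.le

end Stationary

end LStat

/-! ### The strong law for `L`-statistics -/

theorem theorem1 {Ω : Type*} [MeasurableSpace Ω] (P : Measure Ω) [IsProbabilityMeasure P]
    (X : ℕ → Ω → ℝ) (hX : ∀ i, Measurable (X i))
    (hstat : LStat.StrictlyStationary P X) (herg : LStat.ErgodicSeq P X)
    (h : ℝ → ℝ) (hh : Measurable h) (c : (n : ℕ) → Fin n → ℝ)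
    (H : ℝ → ℝ) (hH : H = LStat.quantKernel (P.map (X 0)) h)
    (hcond :
      (LStat.ContinuousOnUnit H ∧ ∃ K : ℝ, ∀ n : ℕ, 1 ≤ n → LStat.weightSize c 1 n ≤ K) ∨
      (∃ (p : ℝ) (q : ℝ≥0∞), 1 ≤ p ∧ (ENNReal.ofReal p)⁻¹ + q⁻¹ = 1 ∧
        Integrable (fun ω => |h (X 0 ω)| ^ p) P ∧
        ∃ K : ℝ, ∀ n : ℕ, 1 ≤ n → LStat.weightSize c q n ≤ K)) :
    (∀ n : ℕ, 1 ≤ n →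
      IntervalIntegrable (fun t => LStat.weightFun c n t * H t) volume 0 1) ∧
    ∀ᵐ ω ∂P, Tendsto (fun n : ℕ => LStat.lStatistic c h X n ω - LStat.centering c H n)
      atTop (𝓝 0) := by
  have hν : IsProbabilityMeasure (P.map (X 0)) :=
    Measure.isProbabilityMeasure_map (hX 0).aemeasurable
  -- Both cases reduce to one statement about a conjugate pair: case (i) is `p = ∞`, `q = 1`, and
  -- case (ii) has `p < ∞`.
  obtain ⟨p, q, K, hq1, hpq, hHp, hK, hconv⟩ : ∃ (p q : ℝ≥0∞) (K : ℝ), 1 ≤ q ∧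
      ENNReal.HolderTriple q p 1 ∧ MemLp H p (volume.restrict (Ioc 0 1)) ∧
      (∀ n : ℕ, 1 ≤ n → LStat.weightSize c q n ≤ K) ∧
      ∀ᵐ ω ∂P, Tendsto (fun n => eLpNorm (LStat.weightFun
        (LStat.orderArray h fun i => X i ω) n - H) p (volume.restrict (Ioc 0 1))) atTop (𝓝 0) := by
    rcases hcond with ⟨hcont, K, hK⟩ | ⟨p, q, hp, hpq, hint, K, hK⟩
    · refine ⟨∞, 1, K, le_rfl, inferInstance, LStat.memLp_top_of_continuousOnUnit hcont, hK, ?_⟩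
      subst hH
      filter_upwards [LStat.ae_glivenkoCantelli hX hstat herg,
        LStat.ae_forall_mem_image_quantile hX hstat] with ω h1 h2
      exact h1.tendsto_eLpNorm_top h2 hcont
    · have hp1 : 1 ≤ ENNReal.ofReal p := ENNReal.one_le_ofReal.2 hp
      have hp0 : ENNReal.ofReal p ≠ 0 := (zero_lt_one.trans_le hp1).ne'
      have hmem : MemLp h (ENNReal.ofReal p) (P.map (X 0)) := by
        rw [← integrable_norm_rpow_iff hh.aestronglyMeasurable hp0 ENNReal.ofReal_ne_top,
          ENNReal.toReal_ofReal (by linarith)]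
        exact (integrable_map_measure
          ((measurable_norm.comp hh).pow_const p).aestronglyMeasurable (hX 0).aemeasurable).2 hint
      subst hH
      refine ⟨ENNReal.ofReal p, q, K, ?_, ⟨?_⟩, LStat.memLp_quantKernel hmem, hK,
        LStat.ae_tendsto_eLpNorm_sub_quantKernel hX hstat herg hh hp1 ENNReal.ofReal_ne_top hmem⟩
      -- The bound `1 ≤ q` is read off from `p⁻¹ + q⁻¹ = 1`.
      · rw [← ENNReal.inv_le_one, ← hpq]
        exact le_add_self
      · rw [add_comm, hpq, inv_one]
  refine ⟨fun n _ => ?_, ?_⟩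
  · rw [intervalIntegrable_iff_integrableOn_Ioc_of_le zero_le_one]
    exact memLp_one_iff_integrable.1 (hHp.smul (LStat.memLp_weightFun c n q))
  · filter_upwards [hconv] with ω hω
    have := LStat.tendsto_mean_sub_integral hq1 hHp hK hω
    simpa only [LStat.lStatistic, LStat.centering, LStat.orderArray,
      intervalIntegral.integral_of_le (zero_le_one' ℝ)] using this
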